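/- For $n\in\mathbb N$ let $h_n:\{0,1\}^*\to\{0,1\}^{m(n)}$ with $m(n)\ge 8$ be a family of hash functions computable, uniformly in $n$, in time polynomial in $n+|x|$ on input $(1^n,x)$. For a seed $s\in\{0,1\}^k$ let $\mathrm{LazyDigest}_{n,s}$ be the infinite byte sequence whose $i$-th entry is $h_n(s\,\|\,i)[0]$, the first byte of the digest of $s$ followed by the decimal ASCII representation of $i$ $(i=0,1,2,\dots)$. A truly random sequence $R=(R[i])_{i\ge 0}$ is a sequence of independent uniformly distributed bytes. Suppose that $\mathrm P=\mathrm{NP}$. Then there is a deterministic polynomial-time algorithm $D$ which takes as input $1^n$, $1^k$ and a finite list of observations $(i,S[i])$, with the following properties. 1. For all $n$, $k$ and every finite list $O$ of pairs $(i,b)$ of an index and a byte, $D(1^n,1^k,O)=1$ if and only if there is a seed $s\in\{0,1\}^k$ with $b=h_n(s\,\|\,i)[0]$ for all $(i,b)\in O$. 2. For all $n$, $k$ and every finite list $I$ of distinct indices, with $s$ uniform in $\{0,1\}^k$, $$\Pr_s\bigl[D(1^n,1^k,(i,\mathrm{LazyDigest}_{n,s}[i])_{i\in I})=1\bigr]=1,\qquad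 \Pr_R\bigl[D(1^n,1^k,(i,R[i])_{i\in I})=1\bigr]\le \frac{2^k}{256^{|I|}}.$$ 3. Consequently $D$ distinguishes LazyDigest from random in polynomial time: for every polynomially bounded seed length $k=\kappa(n)$ there is a polynomial $q$ such that the advantage $$\Bigl|\Pr_s\bigl[D(1^n,1^{\kappa(n)},(i,\mathrm{LazyDigest}_{n,s}[i])_{i<q(n)})=1\bigr]-\Pr_R\bigl[D(1^n,1^{\kappa(n)},(i,R[i])_{i<q(n)})=1\bigr]\Bigr|$$ is not a negligible function of $n$ (a function is negligible if it is $o(n^{-c})$ for every $c$). -/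

import Mathlib

/-! ### Polynomial time, P and NP -/

/-- A string over a three-letter alphabet: the bit strings `x` and `w` separated by the
letter `none`. -/
def encodePair (p : List Bool × List Bool) : List (Option Bool) :=
  p.1.map some ++ none :: p.2.map some

/-- The function `f` from strings over `A` (the codes `enc a` of the inputs `a`) to truth values is
computed by a multi-stack Turing machine in time polynomial in the length of the code. -/
def PolyTimeDecidable {α A : Type} (enc : α → List A) (f : α → Bool) : Prop :=
  Nonempty (Turing.TM2ComputableInPolyTime enc Computability.encodeBool f)

/-- The complexity class P of languages over `{0,1}`. -/
def classP : Set (Language Bool) :=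
  {L | ∃ f : List Bool → Bool, PolyTimeDecidable id f ∧ ∀ x, x ∈ L ↔ f x = true}

/-- The complexity class NP of languages over `{0,1}`: polynomial-time verifiable membership with
certificates of polynomially bounded length. -/
def classNP : Set (Language Bool) :=
  {L | ∃ (V : List Bool × List Bool → Bool) (p : Polynomial ℕ), PolyTimeDecidable encodePair V ∧
    ∀ x, x ∈ L ↔ ∃ w : List Bool, w.length ≤ p.eval x.length ∧ V (x, w) = true}

/-! ### LazyDigest -/

/-- A byte, as its eight bits, most significant bit first. -/
abbrev Byte : Type := Fin 8 → Bool

/-- The byte with value `a` (modulo 256). -/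
def byteOfNat (a : ℕ) : Byte := fun j => a.testBit (7 - (j : ℕ))

/-- The index `i` as a bit string: its usual decimal representation in ASCII. -/
def indexBits (i : ℕ) : List Bool :=
  (Nat.toDigits 10 i).flatMap fun c => List.ofFn (byteOfNat c.toNat)

/-- The code `1ⁿ 0 x` of a security parameter `n` and a bit string `x`. -/
def encodeHashInput (p : ℕ × List Bool) : List Bool :=
  List.replicate p.1 true ++ false :: p.2

/-- The hash functions `h n : {0,1}* → {0,1}^(m n)` are computable by one Turing machine that runs,
on input `1ⁿ 0 x`, in polynomial time. -/
def PolyTimeHashFamily {m : ℕ → ℕ} (h : (n : ℕ) → List Bool → Fin (m n) → Bool) : Prop :=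
  Nonempty (Turing.TM2ComputableInPolyTime encodeHashInput (id : List Bool → List Bool)
    fun p : ℕ × List Bool => List.ofFn (h p.1 p.2))

/-- `LazyDigest[i] = h(seed ‖ i)[0]`, the first byte of the digest. -/
def lazyDigest {l : ℕ} (h : List Bool → Fin l → Bool) (hl : 8 ≤ l) {k : ℕ}
    (seed : Fin k → Bool) (i : ℕ) : Byte :=
  fun j => h (List.ofFn seed ++ indexBits i) (Fin.castLE hl j)

/-! ### Distinguishers -/

/-- What is seen of the sequence `S` when it is observed at the indices in `I`. -/
def observe (S : ℕ → Byte) (I : List ℕ) : List (ℕ × Byte) := I.map fun i => (i, S i)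

/-- The code of a distinguisher's input: security parameter `n` and seed length `k` in unary,
and a list of observations. An observation of the byte `b` at index `i` is written as the ASCII
string of `i`, closed by a zero byte, and the byte `b`. -/
def encodeObservations (p : ℕ × ℕ × List (ℕ × Byte)) : List Bool :=
  List.replicate p.1 true ++ false :: (List.replicate p.2.1 true ++ false ::
    p.2.2.flatMap fun o => indexBits o.1 ++ (List.ofFn (byteOfNat 0) ++ List.ofFn o.2))

/-- The law of a truly random sequence: independent uniformly distributed bytes. -/
noncomputable def randomSequence : MeasureTheory.Measure (ℕ → Byte) :=
  MeasureTheory.Measure.infinitePi fun _ => ProbabilityTheory.uniformOn (Set.univ : Set Byte)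

/-- The probability that the test `T` accepts the observations at the indices in `I` of the
sequence `G s`, where the seed `s` is a uniformly distributed `k`-bit string. -/
noncomputable def acceptSeeded {k : ℕ} (T : List (ℕ × Byte) → Bool)
    (G : (Fin k → Bool) → ℕ → Byte) (I : List ℕ) : ℝ :=
  (ProbabilityTheory.uniformOn (Set.univ : Set (Fin k → Bool))).real
    {s | T (observe (G s) I) = true}

/-- The probability that the test `T` accepts the observations at the indices in `I` of a truly
random sequence. -/
noncomputable def acceptRandom (T : List (ℕ × Byte) → Bool) (I : List ℕ) : ℝ :=
  randomSequence.real {S | T (observe S I) = true}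

/-- A function of the security parameter is negligible if it decays faster than the inverse of
every polynomial. -/
def Negligible (f : ℕ → ℝ) : Prop :=
  Asymptotics.SuperpolynomialDecay Filter.atTop (fun n : ℕ => (n : ℝ)) f

/-- `D` is a (deterministic) polynomial-time distinguisher which tells the sequence generators
`G n`, with seeds of `κ n` bits, from a truly random sequence: on the first `q(n)` bytes, for some
polynomial `q`, its advantage is not negligible. -/
def IsPolyTimeDistinguisher (D : ℕ × ℕ × List (ℕ × Byte) → Bool) (κ : ℕ → ℕ)
    (G : (n : ℕ) → (Fin (κ n) → Bool) → ℕ → Byte) : Prop :=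
  PolyTimeDecidable encodeObservations D ∧
  ∃ q : Polynomial ℕ, ¬ Negligible fun n =>
    |acceptSeeded (fun o => D (n, κ n, o)) (G n) (List.range (q.eval n)) -
      acceptRandom (fun o => D (n, κ n, o)) (List.range (q.eval n))|

/-! ### Composing stack machine programs -/

namespace Turing.TM2

section Relabel

variable {K : Type} [DecidableEq K] {Γ : K → Type} {Λ Λ' σ : Type}

/-- Rename the labels of a statement by `f` and continue with `e` instead of halting. -/
def Stmt.relabel (f : Λ → Λ') (q : Stmt Γ Λ σ) (e : Stmt Γ Λ' σ) : Stmt Γ Λ' σ :=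
  match q with
  | .push k g q => .push k g (q.relabel f e)
  | .peek k g q => .peek k g (q.relabel f e)
  | .pop k g q => .pop k g (q.relabel f e)
  | .load g q => .load g (q.relabel f e)
  | .branch g q₁ q₂ => .branch g (q₁.relabel f e) (q₂.relabel f e)
  | .goto g => .goto fun v => f (g v)
  | .halt => e

/-- The number of statements of a program line. -/
def Stmt.size : Stmt Γ Λ σ → ℕ
  | .push _ _ q | .peek _ _ q | .pop _ _ q | .load _ q => q.size + 1
  | .branch _ q₁ q₂ => q₁.size + q₂.size
  | .goto _ => 0
  | .halt => 0

theorem stepAux_relabel (f : Λ → Λ') (l₀ : Option Λ') (e : Stmt Γ Λ' σ)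
    (he : ∀ v S, stepAux e v S = ⟨l₀, v, S⟩) (q : Stmt Γ Λ σ) (v : σ) (S : ∀ k, List (Γ k)) :
    stepAux (q.relabel f e) v S =
      ⟨(stepAux q v S).l.elim l₀ fun l => some (f l), (stepAux q v S).var,
        (stepAux q v S).stk⟩ := by
  induction q generalizing v S with
  | push k g q ih | peek k g q ih | pop k g q ih | load g q ih =>
    simpa only [Stmt.relabel, stepAux] using ih _ _
  | branch g q₁ q₂ ih₁ ih₂ =>
    simp only [Stmt.relabel, stepAux]
    cases g v
    · exact ih₂ _ _
    · exact ih₁ _ _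
  | goto g => rfl
  | halt => exact he v S

theorem length_stk_stepAux_le (q : Stmt Γ Λ σ) (v : σ) (S : ∀ k, List (Γ k)) (k : K) :
    ((stepAux q v S).stk k).length ≤ (S k).length + q.size := by
  induction q generalizing v S with
  | push j g q ih =>
    refine (ih _ _).trans ?_
    rcases eq_or_ne k j with rfl | h
    · simp [Stmt.size]; omega
    · simp [Stmt.size, Function.update_of_ne h]
  | peek j g q ih | load g q ih =>
    refine (ih _ _).trans ?_
    simp [Stmt.size]
  | pop j g q ih =>
    refine (ih _ _).trans ?_
    rcases eq_or_ne k j with rfl | h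
    · simp [Stmt.size]; omega
    · simp [Stmt.size, Function.update_of_ne h]
  | branch g q₁ q₂ ih₁ ih₂ =>
    simp only [stepAux, Stmt.size]
    cases g v
    · exact (ih₂ _ _).trans (by omega)
    · exact (ih₁ _ _).trans (by omega)
  | goto g => exact Nat.le_add_right _ _
  | halt => exact Nat.le_add_right _ _

/-- The program `M` gets from one configuration to another in at most `t` steps. -/
inductive ReachIn (M : Λ → Stmt Γ Λ σ) : ℕ → Cfg Γ Λ σ → Cfg Γ Λ σ → Prop
  | refl (t : ℕ) (c : Cfg Γ Λ σ) : ReachIn M t c c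
  | step {t : ℕ} {l : Λ} {v : σ} {S : ∀ k, List (Γ k)} {c : Cfg Γ Λ σ}
      (h : ReachIn M t (stepAux (M l) v S) c) : ReachIn M (t + 1) ⟨some l, v, S⟩ c

namespace ReachIn

variable {M : Λ → Stmt Γ Λ σ} {M' : Λ' → Stmt Γ Λ' σ}

theorem mono {t t' : ℕ} {a b : Cfg Γ Λ σ} (h : ReachIn M t a b) (ht : t ≤ t') :
    ReachIn M t' a b := by
  induction h generalizing t' with
  | refl => exact refl _ _
  | step _ ih =>
    obtain ⟨s, rfl⟩ : ∃ s, t' = s + 1 := ⟨t' - 1, by omega⟩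
    exact step (ih (by omega))

theorem trans {t t' : ℕ} {a b c : Cfg Γ Λ σ} (h : ReachIn M t a b) (h' : ReachIn M t' b c) :
    ReachIn M (t + t') a c := by
  induction h with
  | refl => exact h'.mono (by omega)
  | step _ ih => exact (step (ih h')).mono (by omega)

theorem exists_iterate {t : ℕ} {a b : Cfg Γ Λ σ} (h : ReachIn M t a b) :
    ∃ n ≤ t, (flip bind (TM2.step M))^[n] (some a) = some b := by
  induction h with
  | refl => exact ⟨0, Nat.zero_le _, rfl⟩
  | step _ ih =>
    obtain ⟨n, hn, e⟩ := ih
    exact ⟨n + 1, by omega, e⟩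

theorem of_iterate {n : ℕ} {a b : Cfg Γ Λ σ}
    (h : (flip bind (TM2.step M))^[n] (some a) = some b) : ReachIn M n a b := by
  induction n generalizing a with
  | zero => cases h; exact refl _ _
  | succ n ih =>
    obtain ⟨l, v, S⟩ := a
    cases l with
    | some l => exact step (ih h)
    | none =>
      have h0 : (flip bind (TM2.step M))^[n] none = none := Function.iterate_fixed rfl n
      exact absurd (h0.symm.trans h) (by simp)

theorem relabel {f : Λ → Λ'} {l₀ : Option Λ'} {e : Stmt Γ Λ' σ}
    (he : ∀ v S, stepAux e v S = ⟨l₀, v, S⟩) (hM : ∀ l, M' (f l) = (M l).relabel f e)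
    {t : ℕ} {a b : Cfg Γ Λ σ} (h : ReachIn M t a b) :
    ReachIn M' t ⟨a.l.elim l₀ fun l => some (f l), a.var, a.stk⟩
      ⟨b.l.elim l₀ fun l => some (f l), b.var, b.stk⟩ := by
  induction h with
  | refl => exact refl _ _
  | step _ ih =>
    refine step ?_
    rw [hM, stepAux_relabel f l₀ e he]
    exact ih

theorem length_stk_le {C : ℕ} (hC : ∀ l, (M l).size ≤ C) {t : ℕ} {a b : Cfg Γ Λ σ}
    (h : ReachIn M t a b) (k : K) : (b.stk k).length ≤ (a.stk k).length + t * C := by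
  induction h with
  | refl => exact Nat.le_add_right _ _
  | @step t l v S c _ ih =>
    have h1 := length_stk_stepAux_le (M l) v S k
    have h2 := hC l
    refine ih.trans ?_
    simp only [add_mul, one_mul]
    omega

end ReachIn

end Relabel

/-- A program over given stacks and variables, with labels of its own. -/
structure Prog {K : Type} (Γ : K → Type) (σ : Type) where
  /-- the labels of the program -/
  Λ : Type
  /-- there are finitely many labels -/
  [fin : Fintype Λ]
  /-- the label at which the program starts -/
  main : Λ
  /-- the lines of the program -/
  m : Λ → Stmt Γ Λ σ

namespace Prog

variable {K : Type} [DecidableEq K] {Γ : K → Type} {σ : Type}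

/-- Started with the variables `v` and the stacks `S`, the program halts with the variables `v'`
and the stacks `S'` after at most `t` steps. -/
def Runs (A : Prog Γ σ) (v : σ) (S : ∀ k, List (Γ k)) (v' : σ) (S' : ∀ k, List (Γ k)) (t : ℕ) :
    Prop :=
  ReachIn A.m t ⟨some A.main, v, S⟩ ⟨none, v', S'⟩

theorem Runs.mono {A : Prog Γ σ} {v v' : σ} {S S' : ∀ k, List (Γ k)} {t t' : ℕ}
    (h : A.Runs v S v' S' t) (ht : t ≤ t') : A.Runs v S v' S' t' :=
  ReachIn.mono h ht

/-- The program which consists of a single line. -/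
def line (q : Stmt Γ Unit σ) : Prog Γ σ where
  Λ := Unit
  main := ()
  m _ := q

theorem runs_line {q : Stmt Γ Unit σ} {v v' : σ} {S S' : ∀ k, List (Γ k)}
    (h : stepAux q v S = ⟨none, v', S'⟩) : (line q).Runs v S v' S' 1 := by
  refine ReachIn.step ?_
  change ReachIn _ 0 (stepAux q v S) _
  rw [h]
  exact ReachIn.refl _ _

/-- Run `A`, then `B`. -/
def seq (A B : Prog Γ σ) : Prog Γ σ :=
  letI := A.fin
  letI := B.fin
  { Λ := A.Λ ⊕ B.Λ
    main := .inl A.main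
    m := Sum.elim (fun l => (A.m l).relabel Sum.inl (.goto fun _ => .inr B.main))
      fun l => (B.m l).relabel Sum.inr .halt }

theorem Runs.seq {A B : Prog Γ σ} {v₁ v₂ v₃ : σ} {S₁ S₂ S₃ : ∀ k, List (Γ k)} {t t' : ℕ}
    (hA : A.Runs v₁ S₁ v₂ S₂ t) (hB : B.Runs v₂ S₂ v₃ S₃ t') :
    (A.seq B).Runs v₁ S₁ v₃ S₃ (t + t') :=
  ReachIn.trans
    (ReachIn.relabel (M' := (A.seq B).m) (f := Sum.inl) (l₀ := some (.inr B.main))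
      (fun _ _ => rfl) (fun _ => rfl) hA)
    (ReachIn.relabel (M' := (A.seq B).m) (f := Sum.inr) (l₀ := none)
      (fun _ _ => rfl) (fun _ => rfl) hB)

/-- Look at the top of the stack `k`; as long as the test succeeds, run `A` and repeat. -/
def loop (k : K) (p : σ → Option (Γ k) → σ) (c : σ → Bool) (A : Prog Γ σ) : Prog Γ σ :=
  letI := A.fin
  { Λ := Option A.Λ
    main := none
    m := fun l => l.elim (.peek k p (.branch c (.goto fun _ => some A.main) .halt))
      fun l => (A.m l).relabel some (.goto fun _ => none) }

theorem runs_loop_of_false {k : K} {p : σ → Option (Γ k) → σ} {c : σ → Bool} {A : Prog Γ σ}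
    {v : σ} {S : ∀ k, List (Γ k)} (h : c (p v (S k).head?) = false) :
    (loop k p c A).Runs v S (p v (S k).head?) S 1 := by
  refine ReachIn.step ?_
  change ReachIn _ 0 (cond (c (p v (S k).head?)) _ _) _
  rw [h]
  exact ReachIn.refl _ _

theorem Runs.loop {k : K} {p : σ → Option (Γ k) → σ} {c : σ → Bool} {A : Prog Γ σ}
    {v₁ v₂ v₃ : σ} {S₁ S₂ S₃ : ∀ k, List (Γ k)} {t t' : ℕ}
    (h : c (p v₁ (S₁ k).head?) = true) (hA : A.Runs (p v₁ (S₁ k).head?) S₁ v₂ S₂ t)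
    (hl : (Prog.loop k p c A).Runs v₂ S₂ v₃ S₃ t') :
    (Prog.loop k p c A).Runs v₁ S₁ v₃ S₃ (t + t' + 1) := by
  refine ReachIn.step ?_
  change ReachIn _ _ (cond (c (p v₁ (S₁ k).head?)) _ _) _
  rw [h]
  exact ReachIn.trans
    (ReachIn.relabel (M' := (Prog.loop k p c A).m) (f := some) (l₀ := some none)
      (fun _ _ => rfl) (fun _ => rfl) hA) hl

/-- The machine which runs the program `A` with input stack `k₀` and output stack `k₁`. -/
def toFinTM2 [Fintype K] (A : Prog Γ σ) [Fintype σ] (v : σ) (k₀ k₁ : K) [Fintype (Γ k₀)] :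
    FinTM2 :=
  letI := A.fin
  { K := K, k₀ := k₀, k₁ := k₁, Γ := Γ, Λ := A.Λ, main := A.main, σ := σ, initialState := v,
    m := A.m }

theorem dite_eq_update (k₀ : K) (x : List (Γ k₀)) :
    (fun k => @dite (List (Γ k)) (k = k₀) (inferInstance) (fun h => by rw [h]; exact x)
      fun _ => []) = Function.update (fun _ => []) k₀ x := by
  funext k
  rcases eq_or_ne k k₀ with rfl | h
  · simp
  · simp [h]

theorem Runs.outputs [Fintype K] {A : Prog Γ σ} [Fintype σ] {v : σ} {k₀ k₁ : K} [Fintype (Γ k₀)]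
    {x : List (Γ k₀)} {y : List (Γ k₁)} {t : ℕ}
    (h : A.Runs v (Function.update (fun _ => []) k₀ x) v (Function.update (fun _ => []) k₁ y) t) :
    Nonempty (TM2OutputsInTime (A.toFinTM2 v k₀ k₁) x (some y) t) := by
  rw [← dite_eq_update, ← dite_eq_update] at h
  obtain ⟨n, hn, e⟩ := ReachIn.exists_iterate h
  exact ⟨⟨⟨n, e⟩, hn⟩⟩

end Prog

end Turing.TM2

/-! ### Programs over registers and an embedded machine -/

namespace Turing.TM2

/-- The names of the stacks of bits which a program uses besides those of an embedded machine. -/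
inductive Reg
  | x | y | hdr | sd | a | tmp | out
  deriving DecidableEq

instance : Fintype Reg where
  elems := {.x, .y, .hdr, .sd, .a, .tmp, .out}
  complete := by rintro (_ | _) <;> simp

/-- The variables which a program uses besides those of an embedded machine. -/
structure Flags where
  /-- the bit read last -/
  cur : Bool
  /-- whether the byte read last was different from zero -/
  z : Bool
  /-- whether all checks have been successful so far -/
  ok : Bool
  deriving Fintype

/-- The alphabets: those of the embedded machine, that of the input stack, and bits. -/
abbrev Alphabet {K : Type} (Γ : K → Type) : K ⊕ Option Reg → Type
  | .inl k => Γ k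
  | .inr none => Option Bool
  | .inr (some _) => Bool

section

variable {K : Type} {Γ : K → Type} {Λ σ : Type}

/-- The stacks of the embedded machine, the input stack and the registers. -/
def mkStacks (H : ∀ k, List (Γ k)) (I : List (Option Bool)) (R : Reg → List Bool) :
    ∀ k, List (Alphabet Γ k)
  | .inl k => H k
  | .inr none => I
  | .inr (some r) => R r

variable (H : ∀ k, List (Γ k)) (I : List (Option Bool)) (R : Reg → List Bool)

@[simp] theorem mkStacks_inl (k : K) : mkStacks H I R (.inl k) = H k := rfl

@[simp] theorem mkStacks_input : mkStacks H I R (.inr none) = I := rfl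

@[simp] theorem mkStacks_reg (r : Reg) : mkStacks H I R (.inr (some r)) = R r := rfl

variable [DecidableEq K]

@[simp] theorem update_mkStacks_inl (k : K) (l : List (Γ k)) :
    Function.update (mkStacks H I R) (.inl k) l = mkStacks (Function.update H k l) I R := by
  funext j
  rcases j with j | _ | r
  · rcases eq_or_ne j k with rfl | h
    · simp
    · simp [h]
  · rfl
  · rfl

@[simp] theorem update_mkStacks_input (l : List (Option Bool)) :
    Function.update (mkStacks H I R) (.inr none) l = mkStacks H l R := by
  funext j
  rcases j with j | _ | r <;> rfl

@[simp] theorem update_mkStacks_reg (r : Reg) (l : List Bool) :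
    Function.update (mkStacks H I R) (.inr (some r)) l = mkStacks H I (Function.update R r l) := by
  funext j
  rcases j with j | _ | s
  · rfl
  · rfl
  · rcases eq_or_ne s r with rfl | h
    · simp
    · simp [h]

/-- Embedding of the statements of a machine into those of a program. -/
def Stmt.lift : Stmt Γ Λ σ → Stmt (Alphabet Γ) Λ (σ × Flags)
  | .push k g q => .push (.inl k) (fun v => g v.1) q.lift
  | .peek k g q => .peek (.inl k) (fun v o => (g v.1 o, v.2)) q.lift
  | .pop k g q => .pop (.inl k) (fun v o => (g v.1 o, v.2)) q.lift
  | .load g q => .load (fun v => (g v.1, v.2)) q.lift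
  | .branch g q₁ q₂ => .branch (fun v => g v.1) q₁.lift q₂.lift
  | .goto g => .goto fun v => g v.1
  | .halt => .halt

theorem stepAux_lift (q : Stmt Γ Λ σ) (v : σ) (F : Flags) :
    stepAux q.lift (v, F) (mkStacks H I R) =
      ⟨(stepAux q v H).l, ((stepAux q v H).var, F), mkStacks (stepAux q v H).stk I R⟩ := by
  induction q generalizing v H with
  | push k g q ih | peek k g q ih | pop k g q ih | load g q ih =>
    simp only [Stmt.lift, stepAux, mkStacks_inl, update_mkStacks_inl]
    exact ih _ _
  | branch g q₁ q₂ ih₁ ih₂ =>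
    simp only [Stmt.lift, stepAux]
    cases g v
    · exact ih₂ _ _
    · exact ih₁ _ _
  | goto g => rfl
  | halt => rfl

theorem ReachIn.lift {M : Λ → Stmt Γ Λ σ} {t : ℕ} {a b : Cfg Γ Λ σ} (h : ReachIn M t a b)
    (F : Flags) :
    ReachIn (fun l => (M l).lift) t ⟨a.l, (a.var, F), mkStacks a.stk I R⟩
      ⟨b.l, (b.var, F), mkStacks b.stk I R⟩ := by
  induction h with
  | refl => exact refl _ _
  | step _ ih =>
    refine step ?_
    rw [stepAux_lift]
    exact ih

end

namespace Prog

variable {K : Type} [DecidableEq K] {Γ : K → Type} {σ : Type}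

/-- Run `A` as long as the stack `k` is not empty. -/
def whileNonempty (k : K ⊕ Option Reg) (A : Prog (Alphabet Γ) (σ × Flags)) :
    Prog (Alphabet Γ) (σ × Flags) :=
  loop k (fun v o => (v.1, { v.2 with cur := o.isSome })) (fun v => v.2.cur) A

theorem runs_whileNonempty_nil {k : K ⊕ Option Reg} {A : Prog (Alphabet Γ) (σ × Flags)}
    {v : σ × Flags} {S : ∀ k, List (Alphabet Γ k)} (h : S k = []) :
    (whileNonempty k A).Runs v S (v.1, { v.2 with cur := false }) S 1 := by
  simpa [h] using! runs_loop_of_false (k := k) (A := A) (v := v) (S := S)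
    (p := fun v o => (v.1, { v.2 with cur := o.isSome })) (c := fun v => v.2.cur) (by simp [h])

theorem Runs.whileNonempty {k : K ⊕ Option Reg} {A : Prog (Alphabet Γ) (σ × Flags)}
    {v₁ v₂ v₃ : σ × Flags} {S₁ S₂ S₃ : ∀ k, List (Alphabet Γ k)} {t t' : ℕ}
    (h : S₁ k ≠ []) (hA : A.Runs (v₁.1, { v₁.2 with cur := true }) S₁ v₂ S₂ t)
    (hl : (Prog.whileNonempty k A).Runs v₂ S₂ v₃ S₃ t') :
    (Prog.whileNonempty k A).Runs v₁ S₁ v₃ S₃ (t + t' + 1) := by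
  have hs : (S₁ k).head?.isSome = true := by
    cases e : S₁ k with
    | nil => exact absurd e h
    | cons => rfl
  exact Runs.loop (p := fun (v : σ × Flags) (o : Option (Alphabet Γ k)) =>
    (v.1, { v.2 with cur := o.isSome })) (c := fun v => v.2.cur) hs (by rw [hs]; exact hA) hl

/-- Pop the register `s` into the current bit. -/
def popReg {Λ : Type} (s : Reg) (q : Stmt (Alphabet Γ) Λ (σ × Flags)) :
    Stmt (Alphabet Γ) Λ (σ × Flags) :=
  .pop (.inr (some s)) (fun v o => (v.1, { v.2 with cur := o.getD false })) q

/-- Push the current bit to the register `d`. -/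
def pushReg {Λ : Type} (d : Reg) (q : Stmt (Alphabet Γ) Λ (σ × Flags)) :
    Stmt (Alphabet Γ) Λ (σ × Flags) :=
  .push (.inr (some d)) (fun v => v.2.cur) q

variable {H : ∀ k, List (Γ k)} {I : List (Option Bool)} {R : Reg → List Bool} {v : σ × Flags}

@[simp] theorem stepAux_popReg {Λ : Type} (s : Reg) (q : Stmt (Alphabet Γ) Λ (σ × Flags)) :
    stepAux (popReg s q) v (mkStacks H I R) =
      stepAux q (v.1, { v.2 with cur := (R s).head?.getD false })
        (mkStacks H I (Function.update R s (R s).tail)) := by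
  simp only [popReg, stepAux, mkStacks_reg, update_mkStacks_reg]

@[simp] theorem stepAux_pushReg {Λ : Type} (d : Reg) (q : Stmt (Alphabet Γ) Λ (σ × Flags)) :
    stepAux (pushReg d q) v (mkStacks H I R) =
      stepAux q v (mkStacks H I (Function.update R d (v.2.cur :: R d))) := by
  simp only [pushReg, stepAux, mkStacks_reg, update_mkStacks_reg]

/-- Empty the register `s`. -/
def drain (s : Reg) : Prog (Alphabet Γ) (σ × Flags) :=
  whileNonempty (.inr (some s)) (line (popReg s .halt))

theorem runs_drain (s : Reg) :
    (drain s).Runs v (mkStacks H I R) (v.1, { v.2 with cur := false })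
      (mkStacks H I (Function.update R s [])) (2 * (R s).length + 1) := by
  generalize hl : R s = l
  induction l generalizing v R with
  | nil =>
    rw [← hl, Function.update_eq_self]
    exact (runs_whileNonempty_nil hl).mono (by omega)
  | cons b l ih =>
    have h1 := runs_line (q := popReg (Γ := Γ) (σ := σ) s .halt) (S := mkStacks H I R)
      (v := (v.1, { v.2 with cur := true })) (by simp; exact ⟨rfl, rfl⟩)
    have h2 := Runs.whileNonempty (by simp [hl]) h1 (ih (by simp [hl]))
    simpa using! h2.mono (by simp; omega)

/-- Empty the register `s`, pushing its bits to `d`. -/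
def move (s d : Reg) : Prog (Alphabet Γ) (σ × Flags) :=
  whileNonempty (.inr (some s)) (line (popReg s (pushReg d .halt)))

theorem runs_move {s d : Reg} (hsd : s ≠ d) :
    (move s d).Runs v (mkStacks H I R) (v.1, { v.2 with cur := false })
      (mkStacks H I (Function.update (Function.update R s []) d ((R s).reverse ++ R d)))
      (2 * (R s).length + 1) := by
  generalize hl : R s = l
  induction l generalizing v R with
  | nil =>
    rw [← hl, Function.update_eq_self, hl, List.reverse_nil, List.nil_append,
      Function.update_eq_self]
    exact (runs_whileNonempty_nil hl).mono (by omega)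
  | cons b l ih =>
    have h1 := runs_line (q := popReg (Γ := Γ) (σ := σ) s (pushReg d .halt)) (S := mkStacks H I R)
      (v := (v.1, { v.2 with cur := true })) (by simp; exact ⟨rfl, rfl⟩)
    have h2 := Runs.whileNonempty (by simp [hl]) h1 (ih (by simp [hl, hsd]))
    have e : ∀ l', Function.update (Function.update (Function.update (Function.update R s l) d
        l') s []) d (l.reverse ++ l') =
        Function.update (Function.update R s []) d (l.reverse ++ l') := by
      intro l'
      rw [Function.update_comm hsd.symm]
      simp
    simpa [hl, hsd.symm, e] using! h2.mono (by simp; omega)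

/-- Push the bits of the register `s` to `d`, using the empty register `t`. -/
def copy (s d t : Reg) : Prog (Alphabet Γ) (σ × Flags) :=
  (whileNonempty (.inr (some s)) (line (popReg s (pushReg d (pushReg t .halt))))).seq (move t s)

theorem runs_copy {s d t : Reg} (hsd : s ≠ d) (hst : s ≠ t) (hdt : d ≠ t) (ht : R t = []) :
    (copy s d t).Runs v (mkStacks H I R) (v.1, { v.2 with cur := false })
      (mkStacks H I (Function.update R d ((R s).reverse ++ R d)))
      (4 * (R s).length + 2) := by
  have key : ∀ (l : List Bool) (R : Reg → List Bool) (v : σ × Flags), R s = l →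
      (whileNonempty (.inr (some s)) (line (popReg s (pushReg d (pushReg t .halt))))).Runs v
        (mkStacks H I R) (v.1, { v.2 with cur := false })
        (mkStacks H I (Function.update (Function.update (Function.update R s []) d
          (l.reverse ++ R d)) t (l.reverse ++ R t))) (2 * l.length + 1) := by
    intro l
    induction l with
    | nil =>
      intro R v hl
      rw [← hl, Function.update_eq_self, hl, List.reverse_nil, List.nil_append,
        Function.update_eq_self, List.nil_append, Function.update_eq_self]
      exact (runs_whileNonempty_nil hl).mono (by omega)
    | cons b l ih =>
      intro R v hl
      have h1 := runs_line (q := popReg (Γ := Γ) (σ := σ) s (pushReg d (pushReg t .halt)))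
        (S := mkStacks H I R) (v := (v.1, { v.2 with cur := true })) (by simp; exact ⟨rfl, rfl⟩)
      have h2 := Runs.whileNonempty (by simp [hl]) h1 (ih _ _ (by simp [hl, hsd, hst]))
      have e : ∀ l₁ l₂ l₃ l₄, Function.update (Function.update (Function.update (Function.update
          (Function.update (Function.update R s l) d l₁) t l₂) s []) d l₃) t l₄ =
          Function.update (Function.update (Function.update R s []) d l₃) t l₄ := by
        intro l₁ l₂ l₃ l₄
        funext r
        simp only [Function.update_apply]
        split_ifs <;> rfl
      simpa [hl, hsd.symm, hst.symm, hdt, hdt.symm, e] using! h2.mono (by simp; omega)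
  have h1 := (key _ R v rfl).seq (runs_move (s := t) (d := s) hst.symm)
  have e : Function.update (Function.update (Function.update (Function.update R s []) d
      ((R s).reverse ++ R d)) t []) s (R s) = Function.update R d ((R s).reverse ++ R d) := by
    funext r
    simp only [Function.update_apply]
    split_ifs <;> simp_all
  simpa [ht, hsd, hst, e] using! h1.mono (t' := 4 * (R s).length + 2) (by simp [ht]; omega)

/-- Move the bits of the register `s` to the stack `k` of the embedded machine. -/
def moveIn (s : Reg) (k : K) (e : Γ k ≃ Bool) : Prog (Alphabet Γ) (σ × Flags) :=
  whileNonempty (.inr (some s)) (line (popReg s (.push (.inl k) (fun v => e.symm v.2.cur) .halt)))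

theorem runs_moveIn (s : Reg) (k : K) (e : Γ k ≃ Bool) :
    (moveIn s k e).Runs v (mkStacks H I R) (v.1, { v.2 with cur := false })
      (mkStacks (Function.update H k ((R s).reverse.map e.symm ++ H k)) I (Function.update R s []))
      (2 * (R s).length + 1) := by
  generalize hl : R s = l
  induction l generalizing v R H with
  | nil =>
    rw [← hl, Function.update_eq_self, hl, List.reverse_nil, List.map_nil, List.nil_append,
      Function.update_eq_self]
    exact (runs_whileNonempty_nil hl).mono (by omega)
  | cons b l ih =>
    have h1 := runs_line (q := popReg (Γ := Γ) (σ := σ) s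
      (.push (.inl k) (fun v => e.symm v.2.cur) .halt)) (S := mkStacks H I R)
      (v := (v.1, { v.2 with cur := true })) (by simp; exact ⟨rfl, rfl⟩)
    have h2 := Runs.whileNonempty (by simp [hl]) h1 (ih (by simp [hl]))
    simpa [hl] using! h2.mono (by simp; omega)

/-- Move the bits on the stack `k` of the embedded machine to the register `d`. -/
def moveOut (k : K) (e : Γ k ≃ Bool) (d : Reg) : Prog (Alphabet Γ) (σ × Flags) :=
  whileNonempty (.inl k)
    (line (.pop (.inl k) (fun v o => (v.1, { v.2 with cur := (o.map e).getD false }))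
      (pushReg d .halt)))

theorem runs_moveOut (k : K) (e : Γ k ≃ Bool) (d : Reg) {l : List Bool}
    (hl : H k = l.map e.symm) :
    (moveOut k e d).Runs v (mkStacks H I R) (v.1, { v.2 with cur := false })
      (mkStacks (Function.update H k []) I (Function.update R d (l.reverse ++ R d)))
      (2 * l.length + 1) := by
  induction l generalizing v R H with
  | nil =>
    rw [List.map_nil] at hl
    rw [← hl, Function.update_eq_self, List.reverse_nil, List.nil_append,
      Function.update_eq_self]
    exact (runs_whileNonempty_nil hl).mono (by omega)
  | cons b l ih =>
    have h1 := runs_line (q := .pop (.inl k)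
      (fun v o => (v.1, { v.2 with cur := (o.map e).getD false }))
      (pushReg (Γ := Γ) (σ := σ) d .halt)) (S := mkStacks H I R)
      (v := (v.1, { v.2 with cur := true })) (by simp; exact ⟨rfl, rfl⟩)
    have h2 := Runs.whileNonempty (by simp [hl]) h1 (ih (by simp [hl]))
    simpa [hl] using! h2.mono (by simp; omega)

/-- The embedded machine as a program. -/
def embed (tm : FinTM2) : Prog (Alphabet tm.Γ) (tm.σ × Flags) :=
  letI := tm.ΛFin
  { Λ := tm.Λ
    main := tm.main
    m := fun l => (tm.m l).lift }

/-- Replace the contents of the register `a` by the output of the embedded machine on it. -/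
def call (tm : FinTM2) (e₀ : tm.Γ tm.k₀ ≃ Bool) (e₁ : tm.Γ tm.k₁ ≃ Bool) :
    Prog (Alphabet tm.Γ) (tm.σ × Flags) :=
  (move .a .tmp).seq <| (moveIn .tmp tm.k₀ e₀).seq <| (embed tm).seq <|
    (moveOut tm.k₁ e₁ .tmp).seq (move .tmp .a)

theorem _root_.Turing.TM2OutputsInTime.reachIn {tm : FinTM2} {l : List (tm.Γ tm.k₀)}
    {l' : List (tm.Γ tm.k₁)} {t : ℕ} (h : TM2OutputsInTime tm l (some l') t) :
    ReachIn tm.m t ⟨some tm.main, tm.initialState, Function.update (fun _ => []) tm.k₀ l⟩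
      ⟨none, tm.initialState, Function.update (fun _ => []) tm.k₁ l'⟩ := by
  rw [← dite_eq_update, ← dite_eq_update]
  exact (ReachIn.of_iterate h.evals_in_steps).mono h.steps_le_m

theorem _root_.Turing.TM2OutputsInTime.length_le {tm : FinTM2} {l : List (tm.Γ tm.k₀)}
    {l' : List (tm.Γ tm.k₁)} {t : ℕ} (h : TM2OutputsInTime tm l (some l') t) :
    l'.length ≤ l.length + t * (@Finset.univ _ tm.ΛFin).sum fun i => (tm.m i).size := by
  have h1 := h.reachIn.length_stk_le (fun i => Finset.single_le_sum
    (f := fun i => (tm.m i).size) (fun _ _ => Nat.zero_le _) (@Finset.mem_univ _ tm.ΛFin i)) tm.k₁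
  have h2 : ∀ k, (Function.update (fun _ => []) tm.k₀ l k).length ≤ l.length := by
    intro k
    rcases eq_or_ne k tm.k₀ with rfl | e
    · simp
    · simp [Function.update_of_ne e]
  have h3 := h2 tm.k₁
  simp only [Function.update_self] at h1
  omega

theorem runs_call {tm : FinTM2} {e₀ : tm.Γ tm.k₀ ≃ Bool} {e₁ : tm.Γ tm.k₁ ≃ Bool} {F : Flags}
    {l : List Bool} {t : ℕ} (htmp : R .tmp = [])
    (h : TM2OutputsInTime tm ((R .a).map e₀.symm) (some (l.map e₁.symm)) t) :
    (call tm e₀ e₁).Runs (tm.initialState, F) (mkStacks (fun _ => []) I R)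
      (tm.initialState, { F with cur := false })
      (mkStacks (fun _ => []) I (Function.update R .a l))
      (4 * (R .a).length + t + 4 * l.length + 4) := by
  have h1 := (h.reachIn.lift I (Function.update R .a []) { F with cur := false })
  have h2 : (embed tm).Runs _ _ _ _ t := h1
  have h3 := (runs_moveOut (v := (tm.initialState, { F with cur := false })) (I := I)
    (R := Function.update R .a []) (H := Function.update (fun _ => []) tm.k₁ (l.map e₁.symm))
    tm.k₁ e₁ .tmp (l := l) (by simp)).seq (runs_move (s := .tmp) (d := .a) (by decide))
  have h4 := (runs_moveIn (v := (tm.initialState, { F with cur := false })) (I := I)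
    (R := Function.update (Function.update R .a []) .tmp (R .a).reverse) (H := fun _ => [])
    .tmp tm.k₀ e₀)
  have h5 := runs_move (Γ := tm.Γ) (σ := tm.σ) (H := fun _ => []) (I := I) (R := R)
    (v := (tm.initialState, F)) (s := .a) (d := .tmp) (by decide)
  have u₁ : Function.update (Function.update R .a []) .tmp [] = Function.update R .a [] := by
    funext r
    cases r <;> simp [htmp]
  have u₂ : Function.update (Function.update (fun _ => []) tm.k₁ (l.map e₁.symm)) tm.k₁ [] =
      (fun _ => [] : ∀ k, List (tm.Γ k)) := by
    rw [Function.update_idem]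
    exact Function.update_eq_self (f := fun _ => []) tm.k₁
  simp [htmp] at h5
  simp [u₁] at h4
  simp [htmp, u₂] at h3
  have h6 := h5.seq (h4.seq (h2.seq h3))
  rw [u₁, Function.update_idem] at h6
  exact h6.mono (by omega)

end Prog

end Turing.TM2

/-! ### The registers of the verifier and its elementary steps -/

namespace Turing.TM2

/-- The registers with the given contents. -/
def regs (x y hdr sd a tmp out : List Bool) : Reg → List Bool
  | .x => x
  | .y => y
  | .hdr => hdr
  | .sd => sd
  | .a => a
  | .tmp => tmp
  | .out => out

section

variable (x y hdr sd a tmp out l : List Bool)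

attribute [simp] regs.eq_1 regs.eq_2 regs.eq_3 regs.eq_4 regs.eq_5 regs.eq_6 regs.eq_7

@[simp] theorem update_regs_x : Function.update (regs x y hdr sd a tmp out) .x l =
    regs l y hdr sd a tmp out := by funext r; cases r <;> rfl

@[simp] theorem update_regs_y : Function.update (regs x y hdr sd a tmp out) .y l =
    regs x l hdr sd a tmp out := by funext r; cases r <;> rfl

@[simp] theorem update_regs_hdr : Function.update (regs x y hdr sd a tmp out) .hdr l =
    regs x y l sd a tmp out := by funext r; cases r <;> rfl

@[simp] theorem update_regs_sd : Function.update (regs x y hdr sd a tmp out) .sd l =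
    regs x y hdr l a tmp out := by funext r; cases r <;> rfl

@[simp] theorem update_regs_a : Function.update (regs x y hdr sd a tmp out) .a l =
    regs x y hdr sd l tmp out := by funext r; cases r <;> rfl

@[simp] theorem update_regs_out : Function.update (regs x y hdr sd a tmp out) .out l =
    regs x y hdr sd a tmp l := by funext r; cases r <;> rfl

end

namespace Prog

variable {K : Type} [DecidableEq K] {Γ : K → Type} {σ : Type}
variable {H : ∀ k, List (Γ k)} {I : List (Option Bool)} {s : σ} {v : σ × Flags}
variable {x y hdr sd a tmp out : List Bool} {c z ok : Bool}

/-- Clear the current bit and halt. -/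
def clear : Stmt (Alphabet Γ) Unit (σ × Flags) :=
  .load (fun v => (v.1, { v.2 with cur := false })) .halt

@[simp] theorem stepAux_clear {S : ∀ k, List (Alphabet Γ k)} :
    stepAux clear v S = ⟨none, (v.1, { v.2 with cur := false }), S⟩ := rfl

/-- Pop the input stack into the current bit. -/
def popInput (q : Stmt (Alphabet Γ) Unit (σ × Flags)) : Stmt (Alphabet Γ) Unit (σ × Flags) :=
  .pop (.inr none) (fun v o => (v.1, { v.2 with cur := o.join.getD false })) q

@[simp] theorem stepAux_popInput (q : Stmt (Alphabet Γ) Unit (σ × Flags)) {R : Reg → List Bool} :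
    stepAux (popInput q) v (mkStacks H I R) =
      stepAux q (v.1, { v.2 with cur := I.head?.join.getD false }) (mkStacks H I.tail R) := by
  simp only [popInput, stepAux, mkStacks_input, update_mkStacks_input]

/-- Move the input before the first separator to the register `x`. -/
def inputLoop : Prog (Alphabet Γ) (σ × Flags) :=
  loop (.inr none) (fun v o => (v.1, { v.2 with cur := o.join.isSome })) (fun v => v.2.cur)
    (line (popInput (pushReg .x .halt)))

/-- Move the input before the first separator to the register `x` and drop the separator. -/
def splitInput : Prog (Alphabet Γ) (σ × Flags) :=
  inputLoop.seq (line (popInput clear))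

theorem runs_splitInput (xs : List Bool) :
    splitInput.Runs v (mkStacks H (xs.map some ++ none :: I) (regs x y hdr sd a tmp out))
      (v.1, { v.2 with cur := false })
      (mkStacks H I (regs (xs.reverse ++ x) y hdr sd a tmp out)) (2 * xs.length + 2) := by
  have key : inputLoop.Runs v
      (mkStacks H (xs.map some ++ none :: I) (regs x y hdr sd a tmp out))
      (v.1, { v.2 with cur := false })
      (mkStacks H (none :: I) (regs (xs.reverse ++ x) y hdr sd a tmp out))
      (2 * xs.length + 1) := by
    induction xs generalizing x v with
    | nil => exact (runs_loop_of_false rfl).mono (by omega)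
    | cons b l ih =>
      have h1 := runs_line (q := popInput (Γ := Γ) (σ := σ) (pushReg .x .halt))
        (S := mkStacks H ((b :: l).map some ++ none :: I) (regs x y hdr sd a tmp out))
        (v := (v.1, { v.2 with cur := true })) (by simp; exact ⟨rfl, rfl⟩)
      have h2 : inputLoop.Runs v
          (mkStacks H ((b :: l).map some ++ none :: I) (regs x y hdr sd a tmp out)) _ _ _ :=
        Runs.loop (by rfl) h1 ih
      simpa using h2.mono (t' := 2 * (l.length + 1) + 1) (by omega)
  exact (key.seq (runs_line (by simp))).mono (by omega)

/-- As long as the top of `y` is `true`, pop it and run the line `q`. -/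
def whileOne (q : Stmt (Alphabet Γ) Unit (σ × Flags)) : Prog (Alphabet Γ) (σ × Flags) :=
  loop (.inr (some .y)) (fun v o => (v.1, { v.2 with cur := o.getD false })) (fun v => v.2.cur)
    (line (popReg .y q))

/-- Read a unary number from `y` to `hdr`. -/
def readHeader : Prog (Alphabet Γ) (σ × Flags) :=
  (whileOne (pushReg .hdr .halt)).seq (line (popReg .y clear))

theorem runs_readHeader :
    readHeader.Runs v (mkStacks H I (regs x y hdr sd a tmp out)) (v.1, { v.2 with cur := false })
      (mkStacks H I (regs x (y.dropWhile id).tail ((y.takeWhile id).reverse ++ hdr) sd a tmp out))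
      (2 * y.length + 2) := by
  have key : (whileOne (pushReg .hdr .halt)).Runs v
      (mkStacks H I (regs x y hdr sd a tmp out)) (v.1, { v.2 with cur := false })
      (mkStacks H I (regs x (y.dropWhile id) ((y.takeWhile id).reverse ++ hdr) sd a tmp out))
      (2 * y.length + 1) := by
    induction y generalizing hdr v with
    | nil => exact (runs_loop_of_false rfl).mono (by omega)
    | cons b l ih =>
      cases b with
      | false => exact (runs_loop_of_false rfl).mono (by omega)
      | true =>
        have h1 := runs_line (q := popReg (Γ := Γ) (σ := σ) .y (pushReg .hdr .halt))
          (S := mkStacks H I (regs x (true :: l) hdr sd a tmp out))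
          (v := (v.1, { v.2 with cur := true })) (by simp; exact ⟨rfl, rfl⟩)
        have h2 : (whileOne (pushReg .hdr .halt)).Runs v
            (mkStacks H I (regs x (true :: l) hdr sd a tmp out)) _ _ _ :=
          Runs.loop (by rfl) h1 ih
        simpa using h2.mono (t' := 2 * (l.length + 1) + 1) (by omega)
  exact (key.seq (runs_line (by simp))).mono (by omega)

/-- Read a unary number from `y` and move that many bits of input to `sd`. -/
def readSeed : Prog (Alphabet Γ) (σ × Flags) :=
  (whileOne (popInput (pushReg .sd .halt))).seq (line (popReg .y clear))

theorem runs_readSeed (w : List Bool) :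
    readSeed.Runs v (mkStacks H (w.map some) (regs x y hdr sd a tmp out))
      (v.1, { v.2 with cur := false })
      (mkStacks H ((w.drop (y.takeWhile id).length).map some) (regs x (y.dropWhile id).tail hdr
        ((w.takeD (y.takeWhile id).length false).reverse ++ sd) a tmp out))
      (2 * y.length + 2) := by
  have key : (whileOne (popInput (pushReg .sd .halt))).Runs v
      (mkStacks H (w.map some) (regs x y hdr sd a tmp out)) (v.1, { v.2 with cur := false })
      (mkStacks H ((w.drop (y.takeWhile id).length).map some) (regs x (y.dropWhile id) hdr
        ((w.takeD (y.takeWhile id).length false).reverse ++ sd) a tmp out))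
      (2 * y.length + 1) := by
    induction y generalizing sd w v with
    | nil => exact (runs_loop_of_false rfl).mono (by omega)
    | cons b l ih =>
      cases b with
      | false => exact (runs_loop_of_false rfl).mono (by omega)
      | true =>
        have hw : (w.map some).head?.join.getD false = w.head?.getD false := by
          cases w <;> rfl
        have h1 := runs_line (q := popReg (Γ := Γ) (σ := σ) .y (popInput (pushReg .sd .halt)))
          (S := mkStacks H (w.map some) (regs x (true :: l) hdr sd a tmp out))
          (v := (v.1, { v.2 with cur := true })) (by simp [-List.head?_map, hw]; exact ⟨rfl, rfl⟩)
        rw [← List.map_tail] at h1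
        have h2 : (whileOne (popInput (pushReg .sd .halt))).Runs v
            (mkStacks H (w.map some) (regs x (true :: l) hdr sd a tmp out)) _ _ _ :=
          Runs.loop (by rfl) h1 (ih _)
        simpa using h2.mono (t' := 2 * (l.length + 1) + 1) (by omega)
  exact (key.seq (runs_line (by simp))).mono (by omega)

/-- Empty the input stack. -/
def drainInput : Prog (Alphabet Γ) (σ × Flags) :=
  whileNonempty (.inr none) (line (popInput .halt))

theorem runs_drainInput {R : Reg → List Bool} :
    drainInput.Runs v (mkStacks H I R) (v.1, { v.2 with cur := false }) (mkStacks H [] R)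
      (2 * I.length + 1) := by
  induction I generalizing v with
  | nil => exact (runs_whileNonempty_nil rfl).mono (by omega)
  | cons b l ih =>
    have h1 := runs_line (q := popInput (Γ := Γ) (σ := σ) .halt) (S := mkStacks H (b :: l) R)
      (v := (v.1, { v.2 with cur := true })) (by simp; exact ⟨rfl, rfl⟩)
    have h2 := Runs.whileNonempty (by simp) h1 ih
    simpa using! h2.mono (by simp; omega)

/-- Move `n` bits from `y` to `x`, and set the flag `z` if one of them is `true`. -/
def readBits : ℕ → Stmt (Alphabet Γ) Unit (σ × Flags)
  | 0 => .halt
  | n + 1 => popReg .y (pushReg .x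
      (.load (fun v => (v.1, { v.2 with cur := false, z := v.2.z || v.2.cur })) (readBits n)))

theorem stepAux_readBits (n : ℕ) :
    stepAux (readBits n) (s, ⟨false, z, ok⟩) (mkStacks H I (regs x y hdr sd a tmp out)) =
      ⟨none, (s, ⟨false, z || (y.takeD n false).any id, ok⟩),
        mkStacks H I (regs ((y.takeD n false).reverse ++ x) (y.drop n) hdr sd a tmp out)⟩ := by
  induction n generalizing x y z with
  | zero => simp [readBits]
  | succ n ih => simp [readBits, ih, Bool.or_assoc]

/-- Move bytes from `y` to `x` up to and including the first zero byte. -/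
def readBytes : Prog (Alphabet Γ) (σ × Flags) :=
  loop (.inr (some .y)) (fun v _ => v) (fun v => v.2.z)
    (line (.load (fun v => (v.1, { v.2 with z := false })) (readBits 8)))

theorem runs_readBytes (y x : List Bool) :
    ∃ ds y', readBytes.Runs (s, ⟨false, true, ok⟩) (mkStacks H I (regs x y hdr sd a tmp out))
        (s, ⟨false, false, ok⟩) (mkStacks H I (regs (ds ++ x) y' hdr sd a tmp out))
        (2 * y.length + 3) ∧
      ds.length ≤ 8 * y.length + 8 ∧ y'.length ≤ y.length - 1 ∧
      ∀ (bs : List Byte) (rest : List Bool), (∀ b ∈ bs, ∃ j, b j = true) →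
        y = bs.flatMap (fun b => List.ofFn b) ++ (List.ofFn (byteOfNat 0) ++ rest) →
        ds = (bs.flatMap (fun b => List.ofFn b) ++ List.ofFn (byteOfNat 0)).reverse ∧
          y' = rest := by
  induction hn : y.length using Nat.strong_induction_on generalizing x y with
  | _ n ih =>
    subst hn
    have h1 := runs_line (q := .load (fun v => (v.1, { v.2 with z := false }))
      (readBits (Γ := Γ) (σ := σ) 8)) (S := mkStacks H I (regs x y hdr sd a tmp out))
      (v := (s, ⟨false, true, ok⟩)) (by simp only [stepAux]; exact stepAux_readBits 8)
    have hbyte : ∀ (b : Byte) (r : List Bool), (List.ofFn b ++ r).takeD 8 false = List.ofFn b :=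
      fun b r => List.takeD_left' (by simp)
    have hdrop : ∀ (b : Byte) (r : List Bool), (List.ofFn b ++ r).drop 8 = r :=
      fun b r => List.drop_left' (by simp)
    rw [Bool.false_or] at h1
    cases hz : (y.takeD 8 false).any id with
    | false =>
      rw [hz] at h1
      refine ⟨(y.takeD 8 false).reverse, y.drop 8, ?_, ?_, ?_, ?_⟩
      · have h2 : readBytes.Runs _ _ _ _ _ := Runs.loop (by rfl) h1 (runs_loop_of_false (by rfl))
        exact h2.mono (by omega)
      · simp
      · simp only [List.length_drop]
        omega
      · rintro (_ | ⟨b, bs⟩) rest hbs rfl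
        · simp only [List.flatMap_nil, List.nil_append, hbyte, hdrop, and_self]
        · obtain ⟨j, hj⟩ := hbs b (by simp)
          rw [List.flatMap_cons, List.append_assoc, hbyte, List.any_eq_false] at hz
          exact absurd hj (hz _ (List.mem_ofFn.2 ⟨j, rfl⟩))
    | true =>
      rw [hz] at h1
      have hy : 0 < y.length := by
        cases y with
        | nil => simp at hz
        | cons => simp
      have hlt : (y.drop 8).length < y.length := by simp only [List.length_drop]; omega
      obtain ⟨ds, y', h2, h3, h4, h5⟩ := ih _ hlt (y.drop 8) ((y.takeD 8 false).reverse ++ x) rfl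
      refine ⟨ds ++ (y.takeD 8 false).reverse, y', ?_, ?_, ?_, ?_⟩
      · rw [List.append_assoc]
        have h6 : readBytes.Runs _ _ _ _ _ := Runs.loop (by rfl) h1 h2
        exact h6.mono (by omega)
      · simp only [List.length_append, List.length_reverse, List.takeD_length]
        omega
      · omega
      · rintro (_ | ⟨b, bs⟩) rest hbs rfl
        · rw [List.flatMap_nil, List.nil_append, hbyte] at hz
          exact absurd hz (by decide)
        · rw [List.flatMap_cons, List.append_assoc, hdrop] at h5
          obtain ⟨rfl, rfl⟩ := h5 bs rest (fun b hb => hbs b (by simp [hb])) rfl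
          rw [List.flatMap_cons, List.append_assoc, hbyte]
          simp

theorem stepAux_popReg_x (n : ℕ) :
    stepAux ((popReg .x)^[n] clear) v (mkStacks H I (regs x y hdr sd a tmp out)) =
      ⟨none, (v.1, { v.2 with cur := false }),
        mkStacks H I (regs (x.drop n) y hdr sd a tmp out)⟩ := by
  induction n generalizing x v with
  | zero => rfl
  | succ n ih => simp [Function.iterate_succ_apply', ih]

/-- Compare the first `n` bits of `y` and `a`. -/
def cmpBits : ℕ → Stmt (Alphabet Γ) Unit (σ × Flags)
  | 0 => clear
  | n + 1 => popReg .y (.pop (.inr (some .a))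
      (fun v o => (v.1, { v.2 with ok := v.2.ok && (v.2.cur == o.getD false) })) (cmpBits n))

theorem stepAux_cmpBits (n : ℕ) :
    stepAux (cmpBits n) (s, ⟨c, z, ok⟩) (mkStacks H I (regs x y hdr sd a tmp out)) =
      ⟨none, (s, ⟨false, z, ok && (y.takeD n false == a.takeD n false)⟩),
        mkStacks H I (regs x (y.drop n) hdr sd (a.drop n) tmp out)⟩ := by
  induction n generalizing y a c ok with
  | zero => simp [cmpBits]
  | succ n ih => simp [cmpBits, ih, Bool.and_assoc]

end Prog

end Turing.TM2

/-! ### The verifier -/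

theorem Polynomial.monotone_eval_nat (P : Polynomial ℕ) : Monotone fun n : ℕ => P.eval n := by
  intro a b hab
  simp only [Polynomial.eval_eq_sum, Polynomial.sum]
  gcongr

theorem exists_byteOfNat_eq_true {a : ℕ} (h : a % 256 ≠ 0) : ∃ j, byteOfNat a j = true := by
  by_contra! hc
  refine h (Nat.eq_of_testBit_eq fun i => ?_)
  rw [show 256 = 2 ^ 8 from rfl, Nat.testBit_mod_two_pow, Nat.zero_testBit]
  by_cases hi : i < 8
  · have := hc ⟨7 - i, by omega⟩
    simp only [byteOfNat] at this
    rw [show 7 - (7 - i) = i by omega] at this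
    simp [this]
  · simp [hi]

theorem indexBits_eq (i : ℕ) : ∃ bs : List Byte, (∀ b ∈ bs, ∃ j, b j = true) ∧
    indexBits i = bs.flatMap fun b => List.ofFn b := by
  refine ⟨(Nat.toDigits 10 i).map fun c => byteOfNat c.toNat, ?_, ?_⟩
  · intro b hb
    obtain ⟨c, hc, rfl⟩ := List.mem_map.1 hb
    have hd := Nat.isDigit_of_mem_toDigits (by norm_num) le_rfl hc
    have h48 : 48 ≤ c.toNat ∧ c.toNat ≤ 57 := by
      simpa [Char.isDigit, UInt32.le_iff_toNat_le] using hd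
    exact exists_byteOfNat_eq_true (by omega)
  · rw [indexBits, List.flatMap_map]

namespace Turing.TM2.Prog

theorem exists_runs_call {g : ℕ → List Bool → List Bool}
    (c : TM2ComputableInPolyTime encodeHashInput (id : List Bool → List Bool)
      fun p : ℕ × List Bool => g p.1 p.2) :
    ∃ P : Polynomial ℕ, ∀ n u, (g n u).length ≤ P.eval (n + 1 + u.length) ∧
      ∀ F I x y hdr sd out, (call c.tm c.inputAlphabet c.outputAlphabet).Runs
        (c.tm.initialState, F)
        (mkStacks (fun _ => []) I (regs x y hdr sd (encodeHashInput (n, u)) [] out))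
        (c.tm.initialState, { F with cur := false })
        (mkStacks (fun _ => []) I (regs x y hdr sd (g n u) [] out))
        (P.eval (n + 1 + u.length)) := by
  set C := (@Finset.univ _ c.tm.ΛFin).sum fun i => (c.tm.m i).size
  refine ⟨4 * .X + c.time + 4 * (.X + c.time * (C : Polynomial ℕ)) + 4, fun n u => ?_⟩
  have hlen : (encodeHashInput (n, u)).length = n + 1 + u.length := by
    simp [encodeHashInput]; omega
  have h := c.outputsFun (n, u)
  have h1 := h.length_le
  simp only [List.length_map, hlen, id] at h1
  change _ ≤ _ + _ * C at h1
  simp only [Polynomial.eval_add, Polynomial.eval_mul, Polynomial.eval_X, Polynomial.eval_natCast,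
    Polynomial.eval_ofNat, Nat.cast_id]
  refine ⟨by omega, fun F I x y hdr sd out => ?_⟩
  have h2 := runs_call (R := regs x y hdr sd (encodeHashInput (n, u)) [] out) (I := I) (F := F)
    (l := g n u) rfl h
  simp only [regs, hlen, update_regs_a] at h2
  exact h2.mono (by omega)

variable {K : Type} [DecidableEq K] {Γ : K → Type} {σ : Type}

/-- Read an observation from `y`, compute the hash value with `A`, and compare. -/
def checkRecord (A : Prog (Alphabet Γ) (σ × Flags)) : Prog (Alphabet Γ) (σ × Flags) :=
  (line (.load (fun v => (v.1, { v.2 with cur := false, z := true })) .halt)).seq <|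
  readBytes.seq <| (line ((popReg .x)^[8] clear)).seq <| (move .x .a).seq <|
  (copy .sd .a .tmp).seq <| (line (pushReg .a .halt)).seq <| (copy .hdr .a .tmp).seq <|
  A.seq <| (line (cmpBits 8)).seq (drain .a)

section

variable {A : Prog (Alphabet Γ) (σ × Flags)} {s : σ} {g : ℕ → List Bool → List Bool}
  {P : Polynomial ℕ}
  (hA : ∀ n u, (g n u).length ≤ P.eval (n + 1 + u.length) ∧ ∀ F I x y hdr sd out, A.Runs (s, F)
    (mkStacks (fun _ => []) I (regs x y hdr sd (encodeHashInput (n, u)) [] out))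
    (s, { F with cur := false })
    (mkStacks (fun _ => []) I (regs x y hdr sd (g n u) [] out)) (P.eval (n + 1 + u.length)))

include hA

theorem runs_checkRecord {N n : ℕ} {seed y : List Bool} (hy : y.length ≤ N) (hn : n ≤ N)
    (hs : seed.length ≤ N) (c z ok : Bool) :
    ∃ ok' y', (checkRecord A).Runs (s, ⟨c, z, ok⟩)
        (mkStacks (fun _ => []) [] (regs [] y (.replicate n true) seed.reverse [] [] []))
        (s, ⟨false, false, ok'⟩)
        (mkStacks (fun _ => []) [] (regs [] y' (.replicate n true) seed.reverse [] [] []))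
        (26 * N + 30 + 3 * P.eval (10 * N + 9)) ∧
      y'.length ≤ y.length - 1 ∧
      ∀ (i : ℕ) (b : Byte) (rest : List Bool),
        y = indexBits i ++ (List.ofFn (byteOfNat 0) ++ (List.ofFn b ++ rest)) →
        y' = rest ∧ ok' = (ok && (List.ofFn b == (g n (seed ++ indexBits i)).takeD 8 false)) := by
  obtain ⟨ds, y', h2, hds, hy', hwf⟩ := runs_readBytes (Γ := Γ) (H := fun _ => []) (I := [])
    (s := s) (hdr := .replicate n true) (sd := seed.reverse) (a := []) (tmp := []) (out := [])
    (ok := ok) y []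
  set d := (ds.drop 8).reverse with hd
  set u := seed ++ d
  have hu : u.length ≤ 9 * N + 8 := by simp [u, hd]; omega
  obtain ⟨hlen, hrun⟩ := hA n u
  have hP : P.eval (n + 1 + u.length) ≤ P.eval (10 * N + 9) :=
    P.monotone_eval_nat (by omega)
  have h1 := runs_line (Γ := Alphabet Γ) (σ := σ × Flags)
    (q := .load (fun v => (v.1, { v.2 with cur := false, z := true })) .halt)
    (v := (s, ⟨c, z, ok⟩))
    (S := mkStacks (fun _ => []) [] (regs [] y (.replicate n true) seed.reverse [] [] [])) rfl
  have h3 := runs_line (stepAux_popReg_x (Γ := Γ) (H := fun _ => []) (I := [])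
    (v := (s, ⟨false, false, ok⟩)) (x := ds ++ []) (y := y') (hdr := .replicate n true)
    (sd := seed.reverse) (a := []) (tmp := []) (out := []) 8)
  have h4 := runs_move (Γ := Γ) (H := fun _ => []) (I := []) (v := (s, ⟨false, false, ok⟩))
    (R := regs (ds.drop 8) y' (.replicate n true) seed.reverse [] [] []) (s := .x) (d := .a)
    (by decide)
  have h5 := runs_copy (Γ := Γ) (H := fun _ => []) (I := []) (v := (s, ⟨false, false, ok⟩))
    (R := regs [] y' (.replicate n true) seed.reverse d [] []) (s := .sd) (d := .a) (t := .tmp)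
    (by decide) (by decide) (by decide) rfl
  have h6 := runs_line (q := pushReg (Γ := Γ) .a .halt) (v := (s, ⟨false, false, ok⟩))
    (S := mkStacks (fun _ => []) [] (regs [] y' (.replicate n true) seed.reverse u [] []))
    (stepAux_pushReg _ _)
  have h7 := runs_copy (Γ := Γ) (H := fun _ => []) (I := []) (v := (s, ⟨false, false, ok⟩))
    (R := regs [] y' (.replicate n true) seed.reverse (false :: u) [] []) (s := .hdr) (d := .a)
    (t := .tmp) (by decide) (by decide) (by decide) rfl
  have h8 := hrun ⟨false, false, ok⟩ [] [] y' (.replicate n true) seed.reverse []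
  have h9 := runs_line (stepAux_cmpBits (Γ := Γ) (H := fun _ => []) (I := []) (s := s)
    (c := false) (z := false) (ok := ok) (x := []) (y := y') (hdr := .replicate n true)
    (sd := seed.reverse) (a := g n u) (tmp := []) (out := []) 8)
  have h10 := runs_drain (Γ := Γ) (H := fun _ => []) (I := [])
    (v := (s, ⟨false, false, ok && (y'.takeD 8 false == (g n u).takeD 8 false)⟩))
    (R := regs [] (y'.drop 8) (.replicate n true) seed.reverse ((g n u).drop 8) [] []) .a
  simp only [List.append_nil, regs, update_regs_x, update_regs_a, List.reverse_reverse,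
    List.reverse_replicate, ← hd] at h2 h3 h4 h5 h6 h7 h8 h9 h10
  have h := h1.seq (h2.seq (h3.seq (h4.seq (h5.seq (h6.seq (h7.seq (h8.seq (h9.seq h10))))))))
  refine ⟨_, _, Runs.mono (A := checkRecord A) h ?_, ?_, ?_⟩
  · simp only [List.length_drop, List.length_reverse, List.length_replicate]
    omega
  · simp only [List.length_drop]
    omega
  · intro i b rest e
    obtain ⟨bs, hbs, hi⟩ := indexBits_eq i
    rw [hi] at e
    obtain ⟨e1, e2⟩ := hwf bs _ hbs e
    have hdi : d = indexBits i := by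
      rw [hd, e1, List.reverse_append, List.drop_left' (by simp), List.reverse_reverse, hi]
    subst e2
    rw [List.drop_left' (by simp), List.takeD_left' (by simp), ← hdi]
    exact ⟨rfl, rfl⟩

/-- Check all observations in `y`. -/
def checkRecords (A : Prog (Alphabet Γ) (σ × Flags)) : Prog (Alphabet Γ) (σ × Flags) :=
  whileNonempty (.inr (some .y)) (checkRecord A)

theorem runs_checkRecords {N n : ℕ} {seed : List Bool} (hn : n ≤ N)
    (hs : seed.length ≤ N) (y : List Bool) (hy : y.length ≤ N) (c z ok : Bool) :
    ∃ ok' z', (checkRecords A).Runs (s, ⟨c, z, ok⟩)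
        (mkStacks (fun _ => []) [] (regs [] y (.replicate n true) seed.reverse [] [] []))
        (s, ⟨false, z', ok'⟩)
        (mkStacks (fun _ => []) [] (regs [] [] (.replicate n true) seed.reverse [] [] []))
        (y.length * (26 * N + 31 + 3 * P.eval (10 * N + 9)) + 1) ∧
      ∀ obs : List (ℕ × Byte),
        y = (obs.flatMap fun o =>
          indexBits o.1 ++ (List.ofFn (byteOfNat 0) ++ List.ofFn o.2)) →
        (ok' = true ↔ ok = true ∧ ∀ o ∈ obs,
          List.ofFn o.2 = (g n (seed ++ indexBits o.1)).takeD 8 false) := by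
  induction hl : y.length using Nat.strong_induction_on generalizing y c z ok with
  | _ l ih =>
    subst hl
    rcases eq_or_ne y [] with rfl | hne
    · refine ⟨ok, z, (runs_whileNonempty_nil rfl).mono (by omega), fun obs e => ?_⟩
      cases obs with
      | nil => simp
      | cons o obs => simp at e
    · have hpos := List.length_pos_of_ne_nil hne
      obtain ⟨ok₁, y₁, h1, hy₁, hwf₁⟩ := runs_checkRecord hA hy hn hs true z ok
      obtain ⟨ok₂, z₂, h2, hwf₂⟩ := ih y₁.length (by omega) y₁ (by omega) false false ok₁ rfl
      refine ⟨ok₂, z₂, (Runs.whileNonempty (v₁ := (s, ⟨c, z, ok⟩)) hne h1 h2).mono ?_, ?_⟩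
      · have : (y₁.length + 1) * (26 * N + 31 + 3 * P.eval (10 * N + 9)) ≤
            y.length * (26 * N + 31 + 3 * P.eval (10 * N + 9)) :=
          Nat.mul_le_mul_right _ (by omega)
        rw [add_mul, one_mul] at this
        omega
      · rintro (_ | ⟨o, obs⟩) e
        · exact absurd e hne
        · rw [List.flatMap_cons, List.append_assoc, List.append_assoc] at e
          obtain ⟨rfl, rfl⟩ := hwf₁ _ _ _ e
          rw [hwf₂ obs rfl]
          simp [and_assoc, -List.ofFn_succ]

end

/-- On the input `1ⁿ 0 1ᵏ 0 y` and the certificate `w`, check the observations in `y`. -/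
def verifier (A : Prog (Alphabet Γ) (σ × Flags)) (s : σ) : Prog (Alphabet Γ) (σ × Flags) :=
  splitInput.seq <| (move .x .y).seq <| readHeader.seq <| readSeed.seq <| drainInput.seq <|
  (line (.load (fun v => (v.1, { v.2 with ok := true })) .halt)).seq <|
  (checkRecords A).seq <| (drain .hdr).seq <| (drain .sd).seq <|
  line (.push (.inr (some .out)) (fun v => v.2.ok)
    (.load (fun _ => (s, ⟨false, false, false⟩)) .halt))

theorem runs_verifier {A : Prog (Alphabet Γ) (σ × Flags)} {s : σ}
    {g : ℕ → List Bool → List Bool} {P : Polynomial ℕ}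
    (hA : ∀ n u, (g n u).length ≤ P.eval (n + 1 + u.length) ∧ ∀ F I x y hdr sd out, A.Runs (s, F)
      (mkStacks (fun _ => []) I (regs x y hdr sd (encodeHashInput (n, u)) [] out))
      (s, { F with cur := false })
      (mkStacks (fun _ => []) I (regs x y hdr sd (g n u) [] out)) (P.eval (n + 1 + u.length)))
    {N : ℕ} (x w : List Bool) (hN : x.length + w.length + 1 ≤ N) :
    ∃ ok : Bool, (verifier A s).Runs (s, ⟨false, false, false⟩)
        (mkStacks (fun _ => []) (encodePair (x, w)) (regs [] [] [] [] [] [] []))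
        (s, ⟨false, false, false⟩)
        (mkStacks (fun _ => []) [] (regs [] [] [] [] [] [] [ok]))
        (N * (26 * N + 31 + 3 * P.eval (10 * N + 9)) + 14 * N + 20) ∧
      ∀ n k obs, x = encodeObservations (n, k, obs) → (ok = true ↔
        ∀ o ∈ obs, List.ofFn o.2 = (g n (w.takeD k false ++ indexBits o.1)).takeD 8 false) := by
  set y₁ := (x.dropWhile id).tail
  set n := (x.takeWhile id).length
  set y₂ := (y₁.dropWhile id).tail
  set k := (y₁.takeWhile id).length
  have hn : n ≤ x.length := (List.takeWhile_sublist _).length_le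
  have hy₁ : y₁.length ≤ x.length :=
    ((List.tail_sublist _).trans (List.dropWhile_sublist _)).length_le
  have hk : k ≤ y₁.length := (List.takeWhile_sublist _).length_le
  have hy₂ : y₂.length ≤ y₁.length :=
    ((List.tail_sublist _).trans (List.dropWhile_sublist _)).length_le
  have htake : x.takeWhile id = .replicate n true :=
    List.eq_replicate_iff.2 ⟨rfl, fun b hb => List.mem_takeWhile_imp hb⟩
  obtain ⟨ok, z, h7, hwf⟩ := runs_checkRecords hA (N := N) (n := n) (seed := w.takeD k false)
    (by omega) (by rw [List.takeD_length]; omega) y₂ (by omega) false false true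
  have h1 := runs_splitInput (Γ := Γ) (H := fun _ => []) (v := (s, ⟨false, false, false⟩))
    (I := w.map some) (x := []) (y := []) (hdr := []) (sd := []) (a := []) (tmp := [])
    (out := []) x
  have h2 := runs_move (Γ := Γ) (H := fun _ => []) (v := (s, ⟨false, false, false⟩))
    (I := w.map some) (R := regs x.reverse [] [] [] [] [] []) (s := .x) (d := .y) (by decide)
  have h3 := runs_readHeader (Γ := Γ) (H := fun _ => []) (v := (s, ⟨false, false, false⟩))
    (I := w.map some) (x := []) (y := x) (hdr := []) (sd := []) (a := []) (tmp := []) (out := [])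
  have h4 := runs_readSeed (Γ := Γ) (H := fun _ => []) (v := (s, ⟨false, false, false⟩))
    (x := []) (y := y₁) (hdr := .replicate n true) (sd := []) (a := []) (tmp := []) (out := []) w
  have h5 := runs_drainInput (Γ := Γ) (H := fun _ => []) (v := (s, ⟨false, false, false⟩))
    (I := (w.drop k).map some)
    (R := regs [] y₂ (.replicate n true) (w.takeD k false).reverse [] [] [])
  have h6 := runs_line (Γ := Alphabet Γ) (σ := σ × Flags)
    (q := .load (fun v => (v.1, { v.2 with ok := true })) .halt)
    (v := (s, ⟨false, false, false⟩)) (S := mkStacks (fun _ => []) []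
      (regs [] y₂ (.replicate n true) (w.takeD k false).reverse [] [] [])) rfl
  have h8 := runs_drain (Γ := Γ) (H := fun _ => []) (v := (s, ⟨false, z, ok⟩)) (I := [])
    (R := regs [] [] (.replicate n true) (w.takeD k false).reverse [] [] []) .hdr
  have h9 := runs_drain (Γ := Γ) (H := fun _ => []) (v := (s, ⟨false, z, ok⟩)) (I := [])
    (R := regs [] [] [] (w.takeD k false).reverse [] [] []) .sd
  have h10 := runs_line (Γ := Alphabet Γ) (σ := σ × Flags)
    (q := .push (.inr (some .out)) (fun v => v.2.ok)
      (.load (fun _ => (s, ⟨false, false, false⟩)) .halt))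
    (v := (s, ⟨false, z, ok⟩))
    (S := mkStacks (fun _ => []) [] (regs [] [] [] [] [] [] []))
    (v' := (s, ⟨false, false, false⟩))
    (S' := mkStacks (fun _ => []) [] (regs [] [] [] [] [] [] [ok])) (by simp)
  simp only [List.append_nil, regs, update_regs_x, update_regs_y, update_regs_hdr, update_regs_sd,
    List.reverse_reverse, List.reverse_replicate, htake] at h1 h2 h3 h4 h5 h8 h9
  have h := h1.seq (h2.seq (h3.seq (h4.seq (h5.seq (h6.seq (h7.seq (h8.seq (h9.seq h10))))))))
  refine ⟨ok, Runs.mono (A := verifier A s) h ?_, ?_⟩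
  · have : y₂.length * (26 * N + 31 + 3 * P.eval (10 * N + 9)) ≤
        N * (26 * N + 31 + 3 * P.eval (10 * N + 9)) := Nat.mul_le_mul_right _ (by omega)
    simp only [List.length_map, List.length_drop, List.length_reverse, List.length_replicate,
      List.takeD_length]
    omega
  · rintro n' k' obs hx
    have key : ∀ (j : ℕ) (l : List Bool),
        ((List.replicate j true ++ false :: l).takeWhile id).length = j ∧
          ((List.replicate j true ++ false :: l).dropWhile id).tail = l := by
      intro j l
      induction j with
      | zero => simp
      | succ j ih => simp [List.replicate_succ]
    have e₁ : n = n' := by simp only [n, hx, encodeObservations, key]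
    have e₂ : k = k' := by simp only [k, y₁, hx, encodeObservations, key]
    have e₃ := hwf obs (by simp only [y₂, y₁, hx, encodeObservations, key])
    rw [e₃, e₁, e₂]
    simp

end Turing.TM2.Prog

/-! ### The distinguisher -/

theorem ofFn_eq_takeD_iff {l : ℕ} (hl : 8 ≤ l) (b : Byte) (f : Fin l → Bool) :
    List.ofFn b = (List.ofFn f).takeD 8 false ↔ b = fun j => f (Fin.castLE hl j) := by
  have : (List.ofFn f).takeD 8 false = List.ofFn fun j : Fin 8 => f (Fin.castLE hl j) := by
    rw [List.takeD_eq_take _ (by simpa using hl)]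
    apply List.ext_getElem
    · rw [List.length_take, List.length_ofFn, List.length_ofFn, min_eq_left hl]
    · intro i h₁ h₂
      rw [List.getElem_take, List.getElem_ofFn, List.getElem_ofFn]
      rfl
  rw [this, List.ofFn_inj]

open Turing Turing.TM2 in
theorem exists_verifier {m : ℕ → ℕ} {h : (n : ℕ) → List Bool → Fin (m n) → Bool}
    (hh : PolyTimeHashFamily h) :
    ∃ V : List Bool × List Bool → Bool, PolyTimeDecidable encodePair V ∧ ∀ n k obs w,
      V (encodeObservations (n, k, obs), w) = true ↔ ∀ o ∈ obs,
        List.ofFn o.2 = (List.ofFn (h n (w.takeD k false ++ indexBits o.1))).takeD 8 false := by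
  obtain ⟨c⟩ := hh
  obtain ⟨P, hP⟩ := Prog.exists_runs_call (g := fun n u => List.ofFn (h n u)) c
  choose V hV hVspec using fun a : List Bool × List Bool =>
    Prog.runs_verifier hP (N := (encodePair a).length) a.1 a.2 (by simp [encodePair])
  let _ := c.tm.kFin
  let _ := c.tm.σFin
  let _ : Fintype (Alphabet c.tm.Γ (.inr none)) := inferInstanceAs (Fintype (Option Bool))
  have hu : ∀ l : List Bool, regs [] [] [] [] [] [] l = Function.update (fun _ => []) .out l := by
    intro l
    funext r
    cases r <;> rfl
  have h0 : mkStacks (Γ := c.tm.Γ) (fun _ => []) [] (fun _ => []) = fun _ => [] := by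
    funext k
    rcases k with k | _ | k <;> rfl
  refine ⟨V, ⟨⟨(Prog.verifier (Prog.call c.tm c.inputAlphabet c.outputAlphabet)
    c.tm.initialState).toFinTM2 (c.tm.initialState, ⟨false, false, false⟩) (.inr none)
    (.inr (some .out)), Equiv.refl (Option Bool), Equiv.refl Bool⟩,
    .X * (26 * .X + 31 + 3 * P.comp (10 * .X + 9)) + 14 * .X + 20, fun a => ?_⟩, fun n k obs w =>
      hVspec (encodeObservations (n, k, obs), w) n k obs rfl⟩
  refine Classical.choice ?_
  have h1 := hV a
  have hnil : Function.update (fun _ : Reg => ([] : List Bool)) .out [] = fun _ => [] :=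
    Function.update_eq_self (f := fun _ : Reg => ([] : List Bool)) .out
  rw [hu, hu, hnil, ← update_mkStacks_reg, ← update_mkStacks_input _ [], h0] at h1
  have h2 := Prog.Runs.outputs (k₀ := (Sum.inr none : c.tm.K ⊕ Option Reg))
    (k₁ := (Sum.inr (some Reg.out) : c.tm.K ⊕ Option Reg)) h1
  have key : ∀ (M : FinTM2) (l l₀ : List (M.Γ M.k₀)) (l' l'₀ : List (M.Γ M.k₁)) (t t₀ : ℕ),
      Nonempty (TM2OutputsInTime M l₀ (some l'₀) t₀) → l = l₀ → l' = l'₀ → t = t₀ →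
      Nonempty (TM2OutputsInTime M l (some l') t) := by
    rintro M _ _ _ _ _ _ h rfl rfl rfl
    exact h
  exact key _ _ _ _ _ _ _ h2 (List.map_id _) (List.map_id _) (by simp)

theorem exists_distinguisher (hPNP : classP = classNP) (m : ℕ → ℕ) (hm : ∀ n, 8 ≤ m n)
    (h : (n : ℕ) → List Bool → Fin (m n) → Bool) (hh : PolyTimeHashFamily h) :
    ∃ D : ℕ × ℕ × List (ℕ × Byte) → Bool, PolyTimeDecidable encodeObservations D ∧
      ∀ (n k : ℕ) (obs : List (ℕ × Byte)), D (n, k, obs) = true ↔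
        ∃ s : Fin k → Bool, ∀ o ∈ obs, o.2 = lazyDigest (h n) (hm n) s o.1 := by
  obtain ⟨V, hV, hspec⟩ := exists_verifier hh
  have hL : {x : List Bool | ∃ w : List Bool, w.length ≤ (Polynomial.X : Polynomial ℕ).eval x.length ∧
      V (x, w) = true} ∈ classNP := ⟨V, .X, hV, fun x => Iff.rfl⟩
  rw [← hPNP] at hL
  obtain ⟨f, ⟨cf⟩, hf⟩ := hL
  refine ⟨fun p => f (encodeObservations p),
    ⟨⟨cf.toTM2ComputableAux, cf.time, fun p => cf.outputsFun (encodeObservations p)⟩⟩,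
    fun n k obs => (hf _).symm.trans ?_⟩
  have key : (∃ w : List Bool, w.length ≤ (encodeObservations (n, k, obs)).length ∧
      ∀ o ∈ obs, o.2 = fun j => h n (w.takeD k false ++ indexBits o.1) (Fin.castLE (hm n) j)) ↔
      ∃ s : Fin k → Bool, ∀ o ∈ obs, o.2 = lazyDigest (h n) (hm n) s o.1 := ?_
  · simp only [← key, ← ofFn_eq_takeD_iff (hm n), ← hspec, Polynomial.eval_X]
    exact Iff.rfl
  constructor
  · rintro ⟨w, -, hw⟩
    let s : Fin k → Bool := fun j => (w.takeD k false)[(j : ℕ)]'(by simp)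
    have hs : List.ofFn s = w.takeD k false := List.ext_getElem (by simp) (by simp [s])
    exact ⟨s, fun o ho => (hw o ho).trans (by rw [← hs]; rfl)⟩
  · rintro ⟨s, hs⟩
    refine ⟨List.ofFn s, ?_, fun o ho => ?_⟩
    · simp [encodeObservations]
      omega
    · rw [List.takeD_eq_take _ (by simp), List.take_of_length_le (by simp)]
      exact hs o ho

/-! ### Probabilities -/

open MeasureTheory ProbabilityTheory

theorem randomSequence_cylinder (S₀ : ℕ → Byte) {I : List ℕ} (hI : I.Nodup) :
    randomSequence {S | ∀ i ∈ I, S i = S₀ i} = (256 ^ I.length)⁻¹ := by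
  have hset : {S : ℕ → Byte | ∀ i ∈ I, S i = S₀ i} =
      Set.pi (I.toFinset : Set ℕ) fun i => {S₀ i} := by
    ext S
    simp [Set.mem_pi]
  have hbyte : ∀ b : Byte, uniformOn (Set.univ : Set Byte) {b} = 256⁻¹ := by
    intro b
    rw [uniformOn_univ]
    simp
  rw [hset, randomSequence, Measure.infinitePi_pi _ (fun _ _ => MeasurableSet.singleton _)]
  simp only [hbyte, Finset.prod_const, List.toFinset_card_of_nodup hI]
  rw [ENNReal.inv_pow]

instance : IsProbabilityMeasure randomSequence := by
  unfold randomSequence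
  infer_instance

theorem acceptRandom_le {k : ℕ} {G : (Fin k → Bool) → ℕ → Byte} {T : List (ℕ × Byte) → Bool}
    (hT : ∀ obs, T obs = true → ∃ s : Fin k → Bool, ∀ o ∈ obs, o.2 = G s o.1)
    {I : List ℕ} (hI : I.Nodup) : acceptRandom T I ≤ 2 ^ k / 256 ^ I.length := by
  have hsub : {S | T (observe S I) = true} ⊆
      ⋃ s ∈ (Finset.univ : Finset (Fin k → Bool)), {S | ∀ i ∈ I, S i = G s i} := by
    intro S hS
    obtain ⟨s, hs⟩ := hT _ hS
    simp only [Finset.mem_univ, Set.iUnion_true, Set.mem_iUnion]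
    exact ⟨s, fun i hi => hs (i, S i) (List.mem_map.2 ⟨i, hi, rfl⟩)⟩
  have hreal : ∀ s : Fin k → Bool, randomSequence.real {S | ∀ i ∈ I, S i = G s i} =
      (256 ^ I.length)⁻¹ := by
    intro s
    rw [measureReal_def, randomSequence_cylinder _ hI]
    simp
  refine (measureReal_mono hsub (measure_ne_top _ _)).trans ((measureReal_biUnion_finset_le _ _).trans ?_)
  simp only [hreal, Finset.sum_const, Finset.card_univ, nsmul_eq_mul]
  simp [div_eq_mul_inv]

theorem acceptSeeded_eq_one {k : ℕ} {G : (Fin k → Bool) → ℕ → Byte}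
    {T : List (ℕ × Byte) → Bool}
    (hT : ∀ obs, (∃ s : Fin k → Bool, ∀ o ∈ obs, o.2 = G s o.1) → T obs = true) (I : List ℕ) :
    acceptSeeded T G I = 1 := by
  have : {s | T (observe (G s) I) = true} = Set.univ := by
    refine Set.eq_univ_of_forall fun s => hT _ ⟨s, fun o ho => ?_⟩
    obtain ⟨i, -, rfl⟩ := List.mem_map.1 ho
    rfl
  rw [acceptSeeded, this]
  exact probReal_univ

theorem not_negligible_of_le {f : ℕ → ℝ} {c : ℝ} (hc : 0 < c) (hf : ∀ n, c ≤ f n) :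
    ¬ Negligible f := by
  intro h
  have h0 : Filter.Tendsto f Filter.atTop (nhds 0) := by simpa using h 0
  exact absurd (ge_of_tendsto' h0 hf) (not_le.2 hc)

theorem mainTheorem1 (hPNP : classP = classNP)
    (m : ℕ → ℕ) (hm : ∀ n, 8 ≤ m n)
    (h : (n : ℕ) → List Bool → Fin (m n) → Bool) (hh : PolyTimeHashFamily h) :
    ∃ D : ℕ × ℕ × List (ℕ × Byte) → Bool,
      PolyTimeDecidable encodeObservations D ∧
      (∀ (n k : ℕ) (obs : List (ℕ × Byte)), D (n, k, obs) = true ↔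
        ∃ s : Fin k → Bool, ∀ o ∈ obs, o.2 = lazyDigest (h n) (hm n) s o.1) ∧
      (∀ (n k : ℕ) (I : List ℕ), I.Nodup →
        acceptSeeded (fun o => D (n, k, o)) (lazyDigest (k := k) (h n) (hm n)) I = 1 ∧
        acceptRandom (fun o => D (n, k, o)) I ≤ 2 ^ k / 256 ^ I.length) ∧
      (∀ κ : ℕ → ℕ, (∃ p : Polynomial ℕ, ∀ n, κ n ≤ p.eval n) →
        IsPolyTimeDistinguisher D κ fun n => lazyDigest (k := κ n) (h n) (hm n)) := by
  obtain ⟨D, hD, hspec⟩ := exists_distinguisher hPNP m hm h hh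
  have hprob : ∀ (n k : ℕ) (I : List ℕ), I.Nodup →
      acceptSeeded (fun o => D (n, k, o)) (lazyDigest (k := k) (h n) (hm n)) I = 1 ∧
        acceptRandom (fun o => D (n, k, o)) I ≤ 2 ^ k / 256 ^ I.length := fun n k I hI =>
    ⟨acceptSeeded_eq_one (fun obs => (hspec n k obs).2) I,
      acceptRandom_le (fun obs => (hspec n k obs).1) hI⟩
  refine ⟨D, hD, hspec, hprob, ?_⟩
  rintro κ ⟨p, hp⟩
  refine ⟨hD, p + 1, not_negligible_of_le (c := 1 / 2) (by norm_num) fun n => ?_⟩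
  obtain ⟨h₁, h₂⟩ := hprob n (κ n) (List.range ((p + 1).eval n)) List.nodup_range
  rw [h₁]
  refine le_trans ?_ (le_abs_self _)
  have h₃ : (2 : ℝ) ^ κ n / 256 ^ (List.range ((p + 1).eval n)).length ≤ 1 / 2 := by
    rw [List.length_range, Polynomial.eval_add, Polynomial.eval_one, div_le_iff₀ (by positivity),
      pow_succ]
    have h₄ : (2 : ℝ) ^ κ n ≤ 256 ^ p.eval n :=
      (pow_le_pow_right₀ (by norm_num) (hp n)).trans (pow_le_pow_left₀ (by norm_num) (by norm_num) _)
    have h₅ : (0 : ℝ) < 256 ^ p.eval n := by positivity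
    linarith
  linarith
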